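/- An MV-algebra is an algebra $\langle A,\oplus,\neg,0\rangle$ of type $(2,1,0)$ satisfying $(x\oplus y)\oplus z=x\oplus(y\oplus z)$, $x\oplus y=y\oplus x$, $x\oplus 0=x$, $\neg\neg x=x$, $x\oplus\neg 0=\neg 0$ and $\neg(\neg x\oplus y)\oplus y=\neg(x\oplus\neg y)\oplus x$. For $n\ge 1$ let $L_n=\{k/n: 0\le k\le n\}$ with $a\oplus b=\min(1,a+b)$ and $\neg a=1-a$. A quasivariety is a class of algebras closed under isomorphic images, subalgebras and reduced products (in particular it contains the one-element algebras); a variety is a class closed under homomorphic images, subalgebras and direct products. $\mathbb{Q}(\mathcal{G})$ and $\mathbb{V}(\mathcal{G})$ denote the least quasivariety and the least variety containing $\mathcal{G}$. A class is locally finite if every finitely generated subalgebra of each of its members is finite. A quasivariety is finitely generated if it equals $\mathbb{Q}(\mathcal{G})$ for a finite set $\mathcal{G}$ of finite algebras. An algebra is critical if it is finite and does not belong to the quasivariety generated by its proper subalgebras. **Theorem.** A quasivariety $\mathcal{K}$ of MV-algebras is locally finite if and only if it is finitely generated. Moreover, if $\mathcal{K}$ is locally finite, then there are finitely many integers $n_1,\dots,n_r\ge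 1$ such that $\mathcal{K}\subseteq\mathbb{V}(L_{n_1},\dots,L_{n_r})$, the variety $\mathbb{V}(L_{n_1},\dots,L_{n_r})$ is a proper subclass of the class of all MV-algebras, and it contains only finitely many critical algebras up to isomorphism; and $\mathcal{K}$ is the quasivariety generated by the critical algebras that belong to $\mathcal{K}$. -/

import Mathlib

universe u v

/-- MV-algebras: algebras `⟨A, ⊕, ¬, 0⟩` of type `(2, 1, 0)` satisfying the equations below. -/
class MVAlgebra (A : Type u) where
  oplus : A → A → A
  neg : A → A
  zero : A
  oplus_assoc : ∀ x y z, oplus (oplus x y) z = oplus x (oplus y z)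
  oplus_comm : ∀ x y, oplus x y = oplus y x
  oplus_zero : ∀ x, oplus x zero = x
  neg_neg : ∀ x, neg (neg x) = x
  oplus_neg_zero : ∀ x, oplus x (neg zero) = neg zero
  lukasiewicz : ∀ x y, oplus (neg (oplus (neg x) y)) y = oplus (neg (oplus x (neg y))) x

namespace MV

open MVAlgebra

/-- Homomorphisms of MV-algebras. -/
structure Hom (A : Type u) (B : Type v) [MVAlgebra A] [MVAlgebra B] where
  toFun : A → B
  map_oplus : ∀ x y, toFun (oplus x y) = oplus (toFun x) (toFun y)
  map_neg : ∀ x, toFun (neg x) = neg (toFun x)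
  map_zero : toFun zero = zero

/-- `A` and `B` are isomorphic: there is a bijective homomorphism between them. -/
def Isomorphic (A : Type u) (B : Type v) [MVAlgebra A] [MVAlgebra B] : Prop :=
  ∃ f : Hom A B, Function.Bijective f.toFun

/-- Subalgebras of an MV-algebra. -/
@[ext]
structure Subalg (A : Type u) [MVAlgebra A] where
  carrier : Set A
  oplus_mem : ∀ {x y}, x ∈ carrier → y ∈ carrier → oplus x y ∈ carrier
  neg_mem : ∀ {x}, x ∈ carrier → neg x ∈ carrier
  zero_mem : zero ∈ carrier

/-- A subalgebra with the restricted operations is an MV-algebra. -/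
instance {A : Type u} [MVAlgebra A] (S : Subalg A) : MVAlgebra S.carrier where
  oplus x y := ⟨oplus x.1 y.1, S.oplus_mem x.2 y.2⟩
  neg x := ⟨neg x.1, S.neg_mem x.2⟩
  zero := ⟨zero, S.zero_mem⟩
  oplus_assoc _ _ _ := Subtype.ext (oplus_assoc _ _ _)
  oplus_comm _ _ := Subtype.ext (oplus_comm _ _)
  oplus_zero _ := Subtype.ext (oplus_zero _)
  neg_neg _ := Subtype.ext (MVAlgebra.neg_neg _)
  oplus_neg_zero _ := Subtype.ext (oplus_neg_zero _)
  lukasiewicz _ _ := Subtype.ext (lukasiewicz _ _)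

/-- The subalgebra generated by a set `s`: the intersection of all subalgebras containing `s`. -/
def Subalg.closure {A : Type u} [MVAlgebra A] (s : Set A) : Subalg A where
  carrier := {x | ∀ S : Subalg A, s ⊆ S.carrier → x ∈ S.carrier}
  oplus_mem hx hy S hS := S.oplus_mem (hx S hS) (hy S hS)
  neg_mem hx S hS := S.neg_mem (hx S hS)
  zero_mem S _ := S.zero_mem

/-- A subalgebra is finitely generated if it is generated by a finite set. -/
def Subalg.FG {A : Type u} [MVAlgebra A] (S : Subalg A) : Prop :=
  ∃ s : Set A, s.Finite ∧ Subalg.closure s = S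

/-- Direct products, with componentwise operations. -/
instance {ι : Type v} (A : ι → Type u) [∀ i, MVAlgebra (A i)] : MVAlgebra (∀ i, A i) where
  oplus x y := fun i => oplus (x i) (y i)
  neg x := fun i => neg (x i)
  zero := fun _ => zero
  oplus_assoc _ _ _ := funext fun _ => oplus_assoc _ _ _
  oplus_comm _ _ := funext fun _ => oplus_comm _ _
  oplus_zero _ := funext fun _ => oplus_zero _
  neg_neg _ := funext fun _ => MVAlgebra.neg_neg _
  oplus_neg_zero _ := funext fun _ => oplus_neg_zero _
  lukasiewicz _ _ := funext fun _ => lukasiewicz _ _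

/-- Reduced products: `Filter.Product F A` is the quotient of the direct product `∀ i, A i` by the
relation `∀ᶠ i in F, x i = y i`; the operations are computed on representatives. -/
instance {ι : Type v} (F : Filter ι) (A : ι → Type u) [∀ i, MVAlgebra (A i)] :
    MVAlgebra (F.Product A) where
  oplus := Quotient.map₂ oplus fun _ _ hx _ _ hy =>
    Filter.mp_mem hx (Filter.mp_mem hy (Filter.Eventually.of_forall
      fun _ h h' => congrArg₂ oplus h' h))
  neg := Quotient.map neg fun _ _ hx =>
    Filter.mp_mem hx (Filter.Eventually.of_forall fun _ h => congrArg neg h)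
  zero := Quotient.mk _ zero
  oplus_assoc := by
    rintro ⟨x⟩ ⟨y⟩ ⟨z⟩
    exact congrArg (Quotient.mk _) (oplus_assoc x y z)
  oplus_comm := by
    rintro ⟨x⟩ ⟨y⟩
    exact congrArg (Quotient.mk _) (oplus_comm x y)
  oplus_zero := by
    rintro ⟨x⟩
    exact congrArg (Quotient.mk _) (oplus_zero x)
  neg_neg := by
    rintro ⟨x⟩
    exact congrArg (Quotient.mk _) (MVAlgebra.neg_neg x)
  oplus_neg_zero := by
    rintro ⟨x⟩
    exact congrArg (Quotient.mk _) (oplus_neg_zero x)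
  lukasiewicz := by
    rintro ⟨x⟩ ⟨y⟩
    exact congrArg (Quotient.mk _) (lukasiewicz x y)

/-- The standard MV-algebra `[0, 1] ∩ ℚ`: `a ⊕ b = min 1 (a + b)` and `¬ a = 1 - a`. -/
instance : MVAlgebra (Set.Icc (0 : ℚ) 1) where
  oplus x y := ⟨min 1 (x.1 + y.1), le_min zero_le_one (add_nonneg x.2.1 y.2.1), min_le_left _ _⟩
  neg x := ⟨1 - x.1, sub_nonneg.2 x.2.2, sub_le_self _ x.2.1⟩
  zero := ⟨0, le_rfl, zero_le_one⟩
  oplus_assoc := by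
    rintro ⟨x, hx, hx'⟩ ⟨y, hy, hy'⟩ ⟨z, hz, hz'⟩
    apply Subtype.ext
    change min 1 (min 1 (x + y) + z) = min 1 (x + min 1 (y + z))
    grind
  oplus_comm x y := Subtype.ext (by
    change min 1 (x.1 + y.1) = min 1 (y.1 + x.1)
    rw [add_comm])
  oplus_zero x := Subtype.ext (by
    change min 1 (x.1 + 0) = x.1
    rw [add_zero, min_eq_right x.2.2])
  neg_neg x := Subtype.ext (sub_sub_cancel 1 x.1)
  oplus_neg_zero x := Subtype.ext (by
    change min 1 (x.1 + (1 - 0)) = 1 - 0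
    rw [sub_zero]
    exact min_eq_left (le_add_of_nonneg_left x.2.1))
  lukasiewicz := by
    rintro ⟨x, hx, hx'⟩ ⟨y, hy, hy'⟩
    apply Subtype.ext
    change min 1 (1 - min 1 (1 - x + y) + y) = min 1 (1 - min 1 (x + (1 - y)) + x)
    grind

/-- The finite chain `L_n = {k / n : 0 ≤ k ≤ n}`, for `n ≥ 1`, as a subalgebra of `[0, 1] ∩ ℚ`. -/
def chain (n : ℕ+) : Subalg (Set.Icc (0 : ℚ) 1) where
  carrier := {x | ∃ k : ℕ, k ≤ (n : ℕ) ∧ x.1 = k / (n : ℕ)}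
  oplus_mem := by
    have hn : ((n : ℕ) : ℚ) ≠ 0 := Nat.cast_ne_zero.2 n.ne_zero
    rintro ⟨x, hx⟩ ⟨y, hy⟩ ⟨k, hk, rfl⟩ ⟨l, hl, rfl⟩
    change ∃ m : ℕ, m ≤ (n : ℕ) ∧ min 1 ((k : ℚ) / (n : ℕ) + l / (n : ℕ)) = m / (n : ℕ)
    rw [← add_div]
    rcases le_total (n : ℕ) (k + l) with h | h
    · refine ⟨n, le_rfl, ?_⟩
      rw [div_self hn, min_eq_left]
      rw [le_div_iff₀ (by positivity), one_mul]
      exact_mod_cast h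
    · refine ⟨k + l, h, ?_⟩
      rw [min_eq_right, Nat.cast_add]
      rw [div_le_one₀ (by positivity)]
      exact_mod_cast h
  neg_mem := by
    have hn : ((n : ℕ) : ℚ) ≠ 0 := Nat.cast_ne_zero.2 n.ne_zero
    rintro ⟨x, hx⟩ ⟨k, hk, rfl⟩
    refine ⟨n - k, Nat.sub_le _ _, ?_⟩
    change 1 - (k : ℚ) / (n : ℕ) = _
    rw [Nat.cast_sub hk, sub_div, div_self hn]
  zero_mem := ⟨0, Nat.zero_le _, by
    change (0 : ℚ) = _
    simp⟩

/-- Bundled MV-algebras; classes of MV-algebras are sets `K : Set Alg`. -/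
structure Alg : Type (u + 1) where
  carrier : Type u
  [str : MVAlgebra carrier]

instance : CoeSort Alg.{u} (Type u) := ⟨Alg.carrier⟩

instance (A : Alg.{u}) : MVAlgebra A := A.str

/-- A quasivariety of MV-algebras: a class closed under isomorphic images, subalgebras and
reduced products. -/
structure IsQuasivariety (K : Set Alg.{u}) : Prop where
  iso : ∀ A ∈ K, ∀ B : Alg.{u}, Isomorphic A B → B ∈ K
  sub : ∀ A ∈ K, ∀ S : Subalg A, Alg.mk S.carrier ∈ K
  reducedProduct : ∀ (ι : Type u) (F : Filter ι) (A : ι → Alg.{u}), (∀ i, A i ∈ K) →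
    Alg.mk (F.Product fun i => A i) ∈ K

/-- A variety of MV-algebras: a class closed under homomorphic images, subalgebras and
direct products. -/
structure IsVariety (K : Set Alg.{u}) : Prop where
  hom : ∀ A ∈ K, ∀ B : Alg.{u}, (∃ f : Hom A B, Function.Surjective f.toFun) → B ∈ K
  sub : ∀ A ∈ K, ∀ S : Subalg A, Alg.mk S.carrier ∈ K
  prod : ∀ (ι : Type u) (A : ι → Alg.{u}), (∀ i, A i ∈ K) → Alg.mk (∀ i, A i) ∈ K

/-- `Q(K)`, the least quasivariety containing `K`. -/
def quasivarietyGenerated (K : Set Alg.{u}) : Set Alg.{u} :=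
  ⋂₀ {Q | IsQuasivariety Q ∧ K ⊆ Q}

/-- `V(K)`, the least variety containing `K`. -/
def varietyGenerated (K : Set Alg.{u}) : Set Alg.{u} :=
  ⋂₀ {V | IsVariety V ∧ K ⊆ V}

/-- `V(L_n : n ∈ N)`. Since varieties are closed under isomorphic images, each `L_n` is
represented by all its isomorphic copies in the universe under consideration. -/
def chainVariety (N : Set ℕ+) : Set Alg.{u} :=
  varietyGenerated {A | ∃ n ∈ N, Isomorphic A (chain n).carrier}

/-- An algebra is locally finite if its finitely generated subalgebras are finite. -/
def LocallyFiniteAlg (A : Type u) [MVAlgebra A] : Prop :=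
  ∀ S : Subalg A, S.FG → Finite S.carrier

/-- A class is locally finite if all its members are. -/
def LocallyFiniteClass (K : Set Alg.{u}) : Prop :=
  ∀ A ∈ K, LocallyFiniteAlg A

/-- `K` is the quasivariety generated by some finite set of finite algebras. -/
def FinitelyGeneratedQuasivariety (K : Set Alg.{u}) : Prop :=
  ∃ G : Set Alg.{u}, G.Finite ∧ (∀ A ∈ G, Finite A) ∧ K = quasivarietyGenerated G

/-- A critical algebra is a finite algebra that does not belong to the quasivariety generated by
its proper subalgebras. -/
def IsCritical (A : Alg.{u}) : Prop :=
  Finite A ∧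
    A ∉ quasivarietyGenerated {B | ∃ S : Subalg A, S.carrier ≠ Set.univ ∧ B = Alg.mk S.carrier}

/-- The class `K` has only finitely many members up to isomorphism. -/
def FiniteUpToIso (K : Set Alg.{u}) : Prop :=
  ∃ F : Set Alg.{u}, F.Finite ∧ ∀ A ∈ K, ∃ B ∈ F, Isomorphic A B

end MV

-- The argument turns on two facts: a finite MV-algebra is described by coordinates at its atoms,
-- and local finiteness of a quasivariety bounds the size of those coordinates.
--
-- If `a` is an atom of a finite algebra whose multiples stabilise after `n` steps, then sending `x`
-- to the largest `k ≤ n` with `k a ≤ x` is, after division by `n`, a homomorphism to the chain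
-- `L_n` (`coord_oplus`, `coord_neg`). These coordinates separate points (`eq_of_forall_coord_eq`),
-- so the algebra embeds in a product of finite chains.
--
-- In a locally finite quasivariety one identity `(M + 1) x = M x` holds throughout: otherwise a
-- product of counterexamples would contain an element generating an infinite subalgebra
-- (`LocallyFiniteClass.exists_nmul`). The identity makes every atom order at most `M`, so the
-- finite members, and through them all members, lie in the variety of finitely many chains.
--
-- A critical algebra has at most one atom of each order: with two atoms of equal order it would
-- embed in the square of the proper subalgebra where the two coordinates agree
-- (`IsCritical.atom_unique`). The identity therefore bounds the size of critical algebras, leaving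
-- finitely many up to isomorphism. Since an algebra lies in every quasivariety containing its
-- finitely generated subalgebras, and finite algebras decompose into critical ones by induction on
-- size, these generate the quasivariety.
--
-- Conversely, over finitely many finite generators there are only finitely many term functions in a
-- given number of variables, which gives local finiteness.

universe w

namespace MV

open MVAlgebra

/-! ### Order, truncated difference and meets in an MV-algebra -/

section Arithmetic

variable {A : Type u} [MVAlgebra A]

/-- The top element `¬ 0`. -/
def one : A := neg zero

/-- The natural order of an MV-algebra. -/
def le (x y : A) : Prop := oplus (neg x) y = one

/-- Truncated difference. -/
def sub (x y : A) : A := neg (oplus (neg x) y)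

/-- The lattice meet. -/
def inf (x y : A) : A := sub (oplus x (neg y)) (neg y)

/-- Iterated sums `x ⊕ ⋯ ⊕ x`. -/
def nmul : ℕ → A → A
  | 0, _ => zero
  | k + 1, x => oplus (nmul k x) x

theorem zero_oplus (x : A) : oplus zero x = x := by
  rw [oplus_comm, oplus_zero]

theorem neg_one : neg (one : A) = zero := MVAlgebra.neg_neg _

theorem oplus_one (x : A) : oplus x one = one := oplus_neg_zero x

theorem neg_oplus_self (x : A) : oplus (neg x) x = one := by
  have h := lukasiewicz x (one : A)
  rwa [oplus_one, neg_one, oplus_zero, eq_comm] at h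

theorem le_refl (x : A) : le x x := neg_oplus_self x

theorem le_antisymm {x y : A} (h : le x y) (h' : le y x) : x = y := by
  have e := lukasiewicz x y
  unfold le at h h'
  rw [h, oplus_comm x, h', neg_one, zero_oplus, zero_oplus] at e
  exact e.symm

theorem le_oplus_right (x y : A) : le x (oplus x y) := by
  unfold le
  rw [← oplus_assoc, neg_oplus_self, oplus_comm, oplus_one]

theorem le_oplus_left (x y : A) : le x (oplus y x) := by
  rw [oplus_comm]
  exact le_oplus_right x y

theorem le_iff_exists {x y : A} : le x y ↔ ∃ z, y = oplus x z := by
  constructor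
  · intro h
    have e := lukasiewicz x y
    unfold le at h
    rw [h, neg_one, zero_oplus, oplus_comm] at e
    exact ⟨_, e⟩
  · rintro ⟨z, rfl⟩
    exact le_oplus_right x z

theorem le_trans {x y z : A} (h : le x y) (h' : le y z) : le x z := by
  obtain ⟨p, rfl⟩ := le_iff_exists.1 h
  obtain ⟨q, rfl⟩ := le_iff_exists.1 h'
  rw [oplus_assoc]
  exact le_oplus_right _ _

theorem oplus_le_oplus_right {x y : A} (h : le x y) (z : A) : le (oplus x z) (oplus y z) := by
  obtain ⟨p, rfl⟩ := le_iff_exists.1 h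
  rw [oplus_assoc, oplus_comm p, ← oplus_assoc]
  exact le_oplus_right _ _

theorem oplus_le_oplus {x y z w : A} (h : le x y) (h' : le z w) :
    le (oplus x z) (oplus y w) := by
  refine le_trans (oplus_le_oplus_right h z) ?_
  rw [oplus_comm y, oplus_comm y]
  exact oplus_le_oplus_right h' y

theorem neg_le_neg {x y : A} (h : le x y) : le (neg y) (neg x) := by
  unfold le at *
  rw [MVAlgebra.neg_neg, oplus_comm, h]

theorem le_neg_comm {x y : A} (h : le x (neg y)) : le y (neg x) := by
  have := neg_le_neg h
  rwa [MVAlgebra.neg_neg] at this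

theorem zero_le (x : A) : le zero x := by
  have := le_oplus_right (zero : A) x
  rwa [zero_oplus] at this

theorem eq_zero_of_le_zero {x : A} (h : le x zero) : x = zero := le_antisymm h (zero_le x)

theorem le_one (x : A) : le x one := oplus_one _

theorem sub_le_iff {x y z : A} : le (sub x y) z ↔ le x (oplus y z) := by
  unfold le sub
  rw [MVAlgebra.neg_neg, oplus_assoc]

theorem sub_eq_zero {x y : A} : sub x y = zero ↔ le x y := by
  constructor
  · intro h
    have : le (sub x y) zero := by rw [h]; exact le_refl _
    rwa [sub_le_iff, oplus_zero] at this
  · intro h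
    apply eq_zero_of_le_zero
    rwa [sub_le_iff, oplus_zero]

theorem le_oplus_sub (x y : A) : le x (oplus y (sub x y)) := sub_le_iff.1 (le_refl _)

theorem oplus_sub_of_le {x y : A} (h : le y x) : oplus y (sub x y) = x := by
  have e := lukasiewicz x y
  have h' : oplus x (neg y) = one := by rw [oplus_comm]; exact h
  rw [h', neg_one, zero_oplus] at e
  rw [oplus_comm]
  exact e

theorem sub_le_sub_right {x y : A} (h : le x y) (z : A) : le (sub x z) (sub y z) :=
  sub_le_iff.2 (le_trans h (le_oplus_sub y z))

theorem inf_le_left (x y : A) : le (inf x y) x := by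
  unfold inf
  rw [sub_le_iff, oplus_comm]
  exact le_refl _

theorem inf_comm (x y : A) : inf x y = inf y x := by
  have e := lukasiewicz (neg x) (neg y)
  simp only [MVAlgebra.neg_neg] at e
  unfold inf sub
  rw [e, oplus_comm y]

theorem inf_le_right (x y : A) : le (inf x y) y := by
  rw [inf_comm]
  exact inf_le_left y x

theorem inf_eq_left {x y : A} (h : le x y) : inf x y = x := by
  have h' : oplus (neg x) y = one := h
  rw [inf_comm]
  unfold inf sub
  rw [oplus_comm y, h', neg_one, zero_oplus, MVAlgebra.neg_neg]

theorem inf_mono_left {x y : A} (h : le x y) (z : A) : le (inf x z) (inf y z) :=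
  sub_le_sub_right (oplus_le_oplus_right h _) _

theorem le_inf {x y z : A} (h : le z x) (h' : le z y) : le z (inf x y) := by
  have := inf_mono_left h y
  rwa [inf_eq_left h'] at this

theorem le_oplus_inf {w p q r : A} (h : le w (oplus p q)) (h' : le w (oplus p r)) :
    le w (oplus p (inf q r)) :=
  sub_le_iff.1 (le_inf (sub_le_iff.2 h) (sub_le_iff.2 h'))

/-- Expanding the right side by distributivity of the sum over meets leaves four sums, each of which
dominates `x ⊕ z` or `y`. -/
theorem inf_oplus_le (x z y : A) : le (inf (oplus x z) y) (oplus (inf x y) (inf z y)) := by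
  apply le_oplus_inf
  · rw [oplus_comm (inf x y)]
    apply le_oplus_inf
    · rw [oplus_comm z x]
      exact inf_le_left _ _
    · exact le_trans (inf_le_right _ _) (le_oplus_left _ _)
  · exact le_trans (inf_le_right _ _) (le_oplus_left _ _)

theorem inf_oplus_eq_zero {x z y : A} (h : inf x y = zero) (h' : inf z y = zero) :
    inf (oplus x z) y = zero := by
  have := inf_oplus_le x z y
  rw [h, h', oplus_zero] at this
  exact eq_zero_of_le_zero this

theorem inf_zero_left (x : A) : inf zero x = zero := inf_eq_left (zero_le x)

theorem inf_nmul_eq_zero {x y : A} (h : inf x y = zero) (k : ℕ) : inf (nmul k x) y = zero := by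
  induction k with
  | zero => exact inf_zero_left y
  | succ k ih => exact inf_oplus_eq_zero ih h

theorem inf_nmul_nmul_eq_zero {x y : A} (h : inf x y = zero) (k l : ℕ) :
    inf (nmul k x) (nmul l y) = zero := by
  rw [inf_comm]
  apply inf_nmul_eq_zero
  rw [inf_comm]
  exact inf_nmul_eq_zero h k

theorem inf_neg_eq (x y : A) : inf x (neg y) = sub (oplus x y) y := by
  unfold inf
  rw [MVAlgebra.neg_neg]

/-- By `inf_neg_eq`, the meet of `x` with `¬ y` is exactly what adding `x` to `y` gains over `y`. -/
theorem oplus_eq_of_inf_neg_eq_zero {x y : A} (h : inf x (neg y) = zero) : oplus y x = y := by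
  rw [inf_neg_eq, sub_eq_zero, oplus_comm] at h
  exact le_antisymm h (le_oplus_right _ _)

theorem eq_zero_of_le_neg_of_oplus_eq {x y : A} (h : le x (neg y)) (h' : oplus y x = y) :
    x = zero := by
  have e := inf_neg_eq x y
  rw [inf_eq_left h, oplus_comm, h', sub_eq_zero.2 (le_refl y)] at e
  exact e

/-- Associativity of the partial sum of an MV-algebra. -/
theorem le_neg_oplus {x y z : A} (h : le x (neg y)) (h' : le (oplus x y) (neg z)) :
    le x (neg (oplus y z)) := by
  have h1 : le z (sub (neg x) y) := by
    have := le_neg_comm h'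
    unfold sub
    rwa [MVAlgebra.neg_neg]
  have h2 := oplus_le_oplus (le_refl y) h1
  rw [oplus_sub_of_le (le_neg_comm h)] at h2
  exact le_neg_comm h2

theorem nmul_one (x : A) : nmul 1 x = x := zero_oplus x

theorem nmul_add (k l : ℕ) (x : A) : nmul (k + l) x = oplus (nmul k x) (nmul l x) := by
  induction l with
  | zero => exact (oplus_zero _).symm
  | succ l ih =>
    change oplus (nmul (k + l) x) x = oplus (nmul k x) (oplus (nmul l x) x)
    rw [ih, oplus_assoc]

theorem nmul_le_nmul {k l : ℕ} (h : k ≤ l) (x : A) : le (nmul k x) (nmul l x) := by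
  obtain ⟨m, rfl⟩ := Nat.exists_eq_add_of_le h
  rw [nmul_add]
  exact le_oplus_right _ _

theorem nmul_eq_of_le {k l : ℕ} {x : A} (h : nmul (k + 1) x = nmul k x) (hkl : k ≤ l) :
    nmul l x = nmul k x := by
  induction l, hkl using Nat.le_induction with
  | base => rfl
  | succ l _ ih =>
    change oplus (nmul l x) x = _
    rw [ih]
    exact h

theorem exists_nmul_succ_eq [Finite A] (x : A) : ∃ k, nmul (k + 1) x = nmul k x := by
  obtain ⟨i, j, hne, h⟩ := Finite.exists_ne_map_eq_of_infinite (fun k : ℕ => nmul k x)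
  wlog hij : i < j generalizing i j
  · exact this j i hne.symm h.symm (by omega)
  refine ⟨i, le_antisymm ?_ (nmul_le_nmul (Nat.le_succ i) x)⟩
  have := nmul_le_nmul (Nat.succ_le_of_lt hij) x
  rwa [show nmul j x = nmul i x from h.symm] at this

theorem eq_of_sub_eq_zero {x y : A} (h : sub x y = zero) (h' : sub y x = zero) : x = y :=
  le_antisymm (sub_eq_zero.1 h) (sub_eq_zero.1 h')

end Arithmetic

/-! ### Atoms, their coordinates, and the maps to finite chains -/

section Atoms

variable {A : Type u} [MVAlgebra A]

/-- `a` is an atom of `A`, and `n` is the number of steps in which its multiples stabilise. -/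
structure IsAtomOfOrder (a : A) (n : ℕ) : Prop where
  ne_zero : a ≠ zero
  eq_or_eq : ∀ x, le x a → x = zero ∨ x = a
  stable : nmul (n + 1) a = nmul n a
  minimal : ∀ k < n, nmul (k + 1) a ≠ nmul k a

open Classical in
/-- The largest `k ≤ n` with `k a ≤ x`. -/
noncomputable def coord (a : A) (n : ℕ) (x : A) : ℕ :=
  Nat.findGreatest (fun k => le (nmul k a) x) n

theorem coord_le (a : A) (n : ℕ) (x : A) : coord a n x ≤ n :=
  @Nat.findGreatest_le (fun k => le (nmul k a) x) (fun _ => Classical.propDecidable _) n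

theorem nmul_coord_le (a : A) (n : ℕ) (x : A) : le (nmul (coord a n x) a) x :=
  @Nat.findGreatest_spec 0 (fun k => le (nmul k a) x) (fun _ => Classical.propDecidable _) n
    (Nat.zero_le n) (zero_le x)

theorem le_coord {a : A} {n k : ℕ} {x : A} (hk : k ≤ n) (h : le (nmul k a) x) :
    k ≤ coord a n x :=
  @Nat.le_findGreatest k (fun k => le (nmul k a) x) (fun _ => Classical.propDecidable _) n hk h

namespace IsAtomOfOrder

variable {a : A} {n : ℕ}

theorem pos (h : IsAtomOfOrder a n) : 0 < n := by
  rcases Nat.eq_zero_or_pos n with rfl | hn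
  · have := h.stable
    rw [zero_add, nmul_one] at this
    exact absurd this h.ne_zero
  · exact hn

theorem inf_eq_zero_or_le (h : IsAtomOfOrder a n) (y : A) : inf a y = zero ∨ le a y := by
  rcases h.eq_or_eq _ (inf_le_left a y) with e | e
  · exact .inl e
  · right
    have := inf_le_right a y
    rwa [e] at this

theorem nmul_eq (h : IsAtomOfOrder a n) {k : ℕ} (hk : n ≤ k) : nmul k a = nmul n a :=
  nmul_eq_of_le h.stable hk

theorem nmul_min (h : IsAtomOfOrder a n) (k : ℕ) : nmul (min n k) a = nmul k a := by
  rcases Nat.le_total n k with hk | hk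
  · rw [min_eq_left hk, h.nmul_eq hk]
  · rw [min_eq_right hk]

theorem nmul_le_top (h : IsAtomOfOrder a n) (k : ℕ) : le (nmul k a) (nmul n a) := by
  rw [← h.nmul_min]
  exact nmul_le_nmul (min_le_left _ _) a

theorem le_neg_nmul (h : IsAtomOfOrder a n) {k : ℕ} (hk : k < n) : le a (neg (nmul k a)) := by
  rcases h.inf_eq_zero_or_le (neg (nmul k a)) with e | e
  · exact absurd (oplus_eq_of_inf_neg_eq_zero e) (h.minimal k hk)
  · exact e

theorem le_of_nmul_le (h : IsAtomOfOrder a n) {k l : ℕ} (hk : k ≤ n)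
    (hkl : le (nmul k a) (nmul l a)) : k ≤ l := by
  by_contra! hlt
  exact h.minimal l (by omega)
    (le_antisymm (le_trans (nmul_le_nmul hlt a) hkl) (nmul_le_nmul (Nat.le_succ l) a))

theorem nmul_inj (h : IsAtomOfOrder a n) {k l : ℕ} (hk : k ≤ n) (hl : l ≤ n)
    (e : nmul k a = nmul l a) : k = l :=
  Nat.le_antisymm (h.le_of_nmul_le hk (by rw [e]; exact le_refl _))
    (h.le_of_nmul_le hl (by rw [e]; exact le_refl _))

/-- Subtract from `x` the largest multiple of `a` below it. The remainder is either disjoint from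
`a`, hence contributes nothing below `n a`, or above `a`, which contradicts maximality unless the
coordinate is already `n`. This lets coordinates be computed by meets. -/
theorem inf_top (h : IsAtomOfOrder a n) (x : A) :
    inf x (nmul n a) = nmul (coord a n x) a := by
  apply le_antisymm
  · rcases (coord_le a n x).eq_or_lt with e | hlt
    · rw [e]
      exact inf_le_right _ _
    · have hx := oplus_sub_of_le (nmul_coord_le a n x)
      rcases h.inf_eq_zero_or_le (sub x (nmul (coord a n x) a)) with e | e
      · have h1 := inf_oplus_le (nmul (coord a n x) a) (sub x (nmul (coord a n x) a)) (nmul n a)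
        rw [hx, inf_comm (sub _ _), inf_nmul_eq_zero e, oplus_zero] at h1
        exact le_trans h1 (inf_le_left _ _)
      · have h1 := oplus_le_oplus (le_refl (nmul (coord a n x) a)) e
        rw [hx] at h1
        have := le_coord (k := coord a n x + 1) hlt h1
        omega
  · exact le_inf (nmul_coord_le a n x) (h.nmul_le_top _)

theorem coord_eq (h : IsAtomOfOrder a n) {x : A} {k : ℕ} (hk : k ≤ n)
    (e : inf x (nmul n a) = nmul k a) : coord a n x = k :=
  h.nmul_inj (coord_le a n x) hk ((h.inf_top x).symm.trans e)

theorem coord_nmul (h : IsAtomOfOrder a n) {k : ℕ} (hk : k ≤ n) : coord a n (nmul k a) = k :=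
  h.coord_eq hk (inf_eq_left (h.nmul_le_top k))

theorem coord_zero (h : IsAtomOfOrder a n) : coord a n zero = 0 := h.coord_nmul (Nat.zero_le n)

theorem coord_oplus (h : IsAtomOfOrder a n) (x y : A) :
    coord a n (oplus x y) = min n (coord a n x + coord a n y) := by
  apply h.coord_eq (min_le_left _ _)
  rw [h.nmul_min, nmul_add, ← h.inf_top x, ← h.inf_top y]
  apply le_antisymm (inf_oplus_le _ _ _)
  refine le_inf (oplus_le_oplus (inf_le_left _ _) (inf_le_left _ _)) ?_
  rw [h.inf_top, h.inf_top, ← nmul_add]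
  exact h.nmul_le_top _

/-- Copies of `a` can be moved one at a time across the orthogonality relation until a single one
remains on the left. The right side is then the top multiple, which absorbs `a`, so `a` would be
zero. -/
theorem not_nmul_le_neg (h : IsAtomOfOrder a n) (k l : ℕ) (hk : k < n) (hkl : n ≤ k + l) :
    ¬ le (nmul (k + 1) a) (neg (nmul l a)) := by
  induction k generalizing l with
  | zero =>
    intro hle
    rw [zero_add, nmul_one, h.nmul_eq (by omega)] at hle
    exact h.ne_zero (eq_zero_of_le_neg_of_oplus_eq hle h.stable)
  | succ k ih =>
    intro hle
    apply ih (l + 1) (by omega) (by omega)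
    have := le_neg_oplus (le_neg_comm (h.le_neg_nmul hk)) hle
    rwa [oplus_comm a] at this

/-- Applying `coord_oplus` to `¬ x ⊕ x = 1` shows that the two coordinates sum to at least `n`; a
larger sum is excluded by `not_nmul_le_neg`. -/
theorem coord_neg (h : IsAtomOfOrder a n) (x : A) : coord a n (neg x) = n - coord a n x := by
  have h1 := h.coord_oplus (neg x) x
  have h2 : coord a n (oplus (neg x) x) = n := by
    rw [neg_oplus_self]
    exact h.coord_eq le_rfl (by rw [inf_comm]; exact inf_eq_left (le_one _))
  rw [h2] at h1
  have h3 : coord a n x + coord a n (neg x) ≤ n := by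
    by_contra! hlt
    have hx := coord_le a n x
    have hy := coord_le a n (neg x)
    obtain ⟨k, hk⟩ : ∃ k, coord a n x = k + 1 := ⟨coord a n x - 1, by omega⟩
    apply h.not_nmul_le_neg k (coord a n (neg x)) (by omega) (by omega)
    rw [← hk]
    exact le_trans (nmul_coord_le a n x) (le_neg_comm (nmul_coord_le a n (neg x)))
  omega

theorem coord_sub (h : IsAtomOfOrder a n) (x y : A) :
    coord a n (sub x y) = coord a n x - coord a n y := by
  unfold sub
  rw [h.coord_neg, h.coord_oplus, h.coord_neg]
  have := coord_le a n x
  omega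

theorem inf_eq_zero (h : IsAtomOfOrder a n) {b : A} {m : ℕ} (h' : IsAtomOfOrder b m)
    (hne : a ≠ b) : inf a b = zero := by
  rcases h.inf_eq_zero_or_le b with e | e
  · exact e
  · rcases h'.eq_or_eq a e with e | e
    · exact absurd e h.ne_zero
    · exact absurd e hne

theorem coord_nmul_of_ne (h : IsAtomOfOrder a n) {b : A} {m : ℕ} (h' : IsAtomOfOrder b m)
    (hne : a ≠ b) (k : ℕ) : coord a n (nmul k b) = 0 :=
  h.coord_eq (Nat.zero_le n) (inf_nmul_nmul_eq_zero (h'.inf_eq_zero h hne.symm) k n)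

theorem order_unique (h : IsAtomOfOrder a n) {m : ℕ} (h' : IsAtomOfOrder a m) : n = m := by
  rcases lt_trichotomy n m with hlt | e | hlt
  · exact absurd h.stable (h'.minimal n hlt)
  · exact e
  · exact absurd h'.stable (h.minimal m hlt)

theorem le_of_nmul_succ_eq (h : IsAtomOfOrder a n) {M : ℕ} (hM : nmul (M + 1) a = nmul M a) :
    n ≤ M := by
  by_contra! hlt
  exact h.minimal M hlt hM

/-- The homomorphism onto a finite chain determined by an atom. -/
noncomputable def hom {n : ℕ+} (h : IsAtomOfOrder a n) : Hom A (chain n).carrier where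
  toFun x := ⟨⟨coord a n x / (n : ℕ), by positivity, by
    rw [div_le_one₀ (by exact_mod_cast n.pos)]
    exact_mod_cast coord_le a n x⟩, coord a n x, coord_le a n x, rfl⟩
  map_oplus x y := by
    apply Subtype.ext
    apply Subtype.ext
    change ((coord a n (oplus x y) : ℕ) : ℚ) / (n : ℕ)
      = min 1 ((coord a n x : ℚ) / (n : ℕ) + (coord a n y : ℚ) / (n : ℕ))
    have hn : (0 : ℚ) < (n : ℕ) := by exact_mod_cast n.pos
    rw [h.coord_oplus, ← add_div, Nat.cast_min, ← min_div_div_right hn.le, div_self hn.ne',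
      Nat.cast_add]
  map_neg x := by
    apply Subtype.ext
    apply Subtype.ext
    change ((coord a n (neg x) : ℕ) : ℚ) / (n : ℕ) = 1 - (coord a n x : ℚ) / (n : ℕ)
    have hn : (0 : ℚ) < (n : ℕ) := by exact_mod_cast n.pos
    rw [h.coord_neg, Nat.cast_sub (coord_le a n x), sub_div, div_self hn.ne']
  map_zero := by
    apply Subtype.ext
    apply Subtype.ext
    change ((coord a n zero : ℕ) : ℚ) / (n : ℕ) = 0
    rw [h.coord_zero, Nat.cast_zero, zero_div]

theorem coord_eq_of_hom_eq {n : ℕ+} (h : IsAtomOfOrder a n) {x y : A}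
    (e : h.hom.toFun x = h.hom.toFun y) : coord a n x = coord a n y := by
  have e' : (coord a n x : ℚ) / (n : ℕ) = (coord a n y : ℚ) / (n : ℕ) :=
    congrArg (fun z => z.1.1) e
  have hn : ((n : ℕ) : ℚ) ≠ 0 := Nat.cast_ne_zero.2 n.ne_zero
  exact_mod_cast (div_left_inj' hn).1 e'

end IsAtomOfOrder

theorem exists_isAtomOfOrder_le [Finite A] {x : A} (hx : x ≠ zero) :
    ∃ a n, IsAtomOfOrder a n ∧ le a x := by
  classical
  let _ : PartialOrder A :=
    { le := le
      le_refl := le_refl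
      le_trans := fun _ _ _ => le_trans
      le_antisymm := fun _ _ => le_antisymm }
  obtain ⟨a, ⟨ha0, hax⟩, hmin⟩ := (Set.toFinite {y : A | y ≠ zero ∧ le y x}).exists_minimal
    ⟨x, hx, le_refl x⟩
  refine ⟨a, Nat.find (exists_nmul_succ_eq a), ⟨ha0, ?_, Nat.find_spec (exists_nmul_succ_eq a),
    fun k hk => Nat.find_min (exists_nmul_succ_eq a) hk⟩, hax⟩
  intro y hy
  by_cases hy0 : y = zero
  · exact .inl hy0
  · exact .inr (le_antisymm hy (hmin ⟨hy0, le_trans hy hax⟩ hy))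

/-- If `x` is not below `y`, some atom lies below the nonzero difference `sub x y`, and at that atom
the coordinate of `x` is strictly larger. -/
theorem eq_of_forall_coord_eq [Finite A] {x y : A}
    (H : ∀ a n, IsAtomOfOrder a n → coord a n x = coord a n y) : x = y := by
  have key : ∀ x y : A, (∀ a n, IsAtomOfOrder a n → coord a n x = coord a n y) →
      sub x y = zero := by
    intro x y H
    by_contra hne
    obtain ⟨a, n, ha, hle⟩ := exists_isAtomOfOrder_le hne
    have h1 := ha.coord_sub x y
    have h2 : 1 ≤ coord a n (sub x y) := le_coord ha.pos (by rwa [nmul_one])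
    have := H a n ha
    omega
  exact eq_of_sub_eq_zero (key x y H) (key y x fun a n h => (H a n h).symm)

/-- The element whose coordinate at `b` is replaced by the coordinate at `a`. -/
noncomputable def transfer (a b : A) (n : ℕ) (x : A) : A :=
  oplus (sub x (nmul n b)) (nmul (coord a n x) b)

theorem coord_transfer_self {a b : A} {n : ℕ} (hb : IsAtomOfOrder b n) (x : A) :
    coord b n (transfer a b n x) = coord a n x := by
  unfold transfer
  have := coord_le b n x
  have := coord_le a n x
  rw [hb.coord_oplus, hb.coord_sub, hb.coord_nmul le_rfl, hb.coord_nmul this]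
  omega

theorem coord_transfer_of_ne {a b c : A} {n m : ℕ} (hb : IsAtomOfOrder b n)
    (hc : IsAtomOfOrder c m) (hne : c ≠ b) (x : A) :
    coord c m (transfer a b n x) = coord c m x := by
  unfold transfer
  have := coord_le c m x
  rw [hc.coord_oplus, hc.coord_sub, hc.coord_nmul_of_ne hb hne, hc.coord_nmul_of_ne hb hne]
  omega

/-- Replacing the coordinate at `b` by the coordinate at `a` is an endomorphism. -/
noncomputable def transferHom [Finite A] {a b : A} {n : ℕ} (ha : IsAtomOfOrder a n)
    (hb : IsAtomOfOrder b n) : Hom A A where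
  toFun := transfer a b n
  map_oplus x y := by
    apply eq_of_forall_coord_eq
    intro c m hc
    by_cases hne : c = b
    · subst hne
      obtain rfl := hc.order_unique hb
      rw [hb.coord_oplus]
      simp only [coord_transfer_self hb, ha.coord_oplus]
    · rw [hc.coord_oplus]
      simp only [coord_transfer_of_ne hb hc hne, hc.coord_oplus]
  map_neg x := by
    apply eq_of_forall_coord_eq
    intro c m hc
    by_cases hne : c = b
    · subst hne
      obtain rfl := hc.order_unique hb
      rw [hb.coord_neg]
      simp only [coord_transfer_self hb, ha.coord_neg]
    · rw [hc.coord_neg]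
      simp only [coord_transfer_of_ne hb hc hne, hc.coord_neg]
  map_zero := by
    apply eq_of_forall_coord_eq
    intro c m hc
    by_cases hne : c = b
    · subst hne
      obtain rfl := hc.order_unique hb
      rw [coord_transfer_self hb, ha.coord_zero, hb.coord_zero]
    · rw [coord_transfer_of_ne hb hc hne]

/-- The subalgebra of elements whose coordinates at `a` and `b` agree. -/
def coordEqualizer {a b : A} {n : ℕ} (ha : IsAtomOfOrder a n) (hb : IsAtomOfOrder b n) :
    Subalg A where
  carrier := {x | coord a n x = coord b n x}
  oplus_mem {x y} hx hy := by
    change coord _ _ _ = coord _ _ _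
    rw [ha.coord_oplus, hb.coord_oplus, show coord a n x = _ from hx, show coord a n y = _ from hy]
  neg_mem {x} hx := by
    change coord _ _ _ = coord _ _ _
    rw [ha.coord_neg, hb.coord_neg, show coord a n x = _ from hx]
  zero_mem := by
    change coord _ _ _ = coord _ _ _
    rw [ha.coord_zero, hb.coord_zero]

theorem coordEqualizer_ne_univ {a b : A} {n : ℕ} (ha : IsAtomOfOrder a n)
    (hb : IsAtomOfOrder b n) (hne : a ≠ b) : (coordEqualizer ha hb).carrier ≠ Set.univ := by
  intro h
  have h1 : nmul 1 a ∈ (coordEqualizer ha hb).carrier := h ▸ Set.mem_univ _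
  change coord a n (nmul 1 a) = coord b n (nmul 1 a) at h1
  rw [ha.coord_nmul ha.pos, hb.coord_nmul_of_ne ha hne.symm] at h1
  exact absurd h1 one_ne_zero

theorem transfer_mem_coordEqualizer {a b : A} {n : ℕ} (ha : IsAtomOfOrder a n)
    (hb : IsAtomOfOrder b n) (hne : a ≠ b) (x : A) :
    transfer a b n x ∈ (coordEqualizer ha hb).carrier := by
  change coord _ _ _ = coord _ _ _
  rw [coord_transfer_self hb, coord_transfer_of_ne hb ha hne]

theorem transfer_mem_coordEqualizer' {a b : A} {n : ℕ} (ha : IsAtomOfOrder a n)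
    (hb : IsAtomOfOrder b n) (hne : a ≠ b) (x : A) :
    transfer b a n x ∈ (coordEqualizer ha hb).carrier :=
  (transfer_mem_coordEqualizer hb ha hne.symm x).symm

/-- Each transfer forgets only the coordinate it overwrites, so the two together retain all of them.
-/
theorem eq_of_transfer_eq [Finite A] {a b : A} {n : ℕ} (ha : IsAtomOfOrder a n)
    (hb : IsAtomOfOrder b n) (hne : a ≠ b) {x y : A}
    (h : transfer a b n x = transfer a b n y) (h' : transfer b a n x = transfer b a n y) :
    x = y := by
  apply eq_of_forall_coord_eq
  intro c m hc
  by_cases hcb : c = b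
  · subst hcb
    rw [← coord_transfer_of_ne (a := c) ha hc hne.symm, h', coord_transfer_of_ne ha hc hne.symm]
  · rw [← coord_transfer_of_ne (a := a) hb hc hcb, h, coord_transfer_of_ne hb hc hcb]

end Atoms

/-! ### Homomorphisms and isomorphisms -/

section Homs

variable {A : Type u} {B : Type v} {C : Type w} [MVAlgebra A] [MVAlgebra B] [MVAlgebra C]

/-- Composition of homomorphisms. -/
def Hom.comp (g : Hom B C) (f : Hom A B) : Hom A C where
  toFun x := g.toFun (f.toFun x)
  map_oplus x y := by rw [f.map_oplus, g.map_oplus]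
  map_neg x := by rw [f.map_neg, g.map_neg]
  map_zero := by rw [f.map_zero, g.map_zero]

/-- The inclusion of a subalgebra. -/
def Subalg.incl (S : Subalg A) : Hom S.carrier A where
  toFun := Subtype.val
  map_oplus _ _ := rfl
  map_neg _ := rfl
  map_zero := rfl

/-- Restriction of the codomain to a subalgebra containing the range. -/
def Hom.codRestrict (f : Hom A B) (S : Subalg B) (h : ∀ x, f.toFun x ∈ S.carrier) :
    Hom A S.carrier where
  toFun x := ⟨f.toFun x, h x⟩
  map_oplus x y := Subtype.ext (f.map_oplus x y)
  map_neg x := Subtype.ext (f.map_neg x)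
  map_zero := Subtype.ext f.map_zero

/-- The range of a homomorphism. -/
def Hom.range (f : Hom A B) : Subalg B where
  carrier := Set.range f.toFun
  oplus_mem := by
    rintro _ _ ⟨x, rfl⟩ ⟨y, rfl⟩
    exact ⟨_, f.map_oplus x y⟩
  neg_mem := by
    rintro _ ⟨x, rfl⟩
    exact ⟨_, f.map_neg x⟩
  zero_mem := ⟨_, f.map_zero⟩

/-- Homomorphisms into the factors give a homomorphism into the product. -/
def Hom.pi {ι : Type w} {A : ι → Type v} [∀ i, MVAlgebra (A i)] {B : Type u} [MVAlgebra B]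
    (f : ∀ i, Hom B (A i)) : Hom B (∀ i, A i) where
  toFun x i := (f i).toFun x
  map_oplus x y := funext fun i => (f i).map_oplus x y
  map_neg x := funext fun i => (f i).map_neg x
  map_zero := funext fun i => (f i).map_zero

/-- The projections of a product. -/
def Hom.proj {ι : Type w} (A : ι → Type v) [∀ i, MVAlgebra (A i)] (i : ι) :
    Hom (∀ i, A i) (A i) where
  toFun x := x i
  map_oplus _ _ := rfl
  map_neg _ := rfl
  map_zero := rfl

/-- The quotient map from a product onto a reduced product. -/
def Hom.toReducedProduct {ι : Type w} (F : Filter ι) (A : ι → Type v) [∀ i, MVAlgebra (A i)] :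
    Hom (∀ i, A i) (F.Product A) where
  toFun x := Quotient.mk _ x
  map_oplus _ _ := rfl
  map_neg _ := rfl
  map_zero := rfl

theorem Hom.map_nmul (f : Hom A B) (k : ℕ) (x : A) : f.toFun (nmul k x) = nmul k (f.toFun x) := by
  induction k with
  | zero => exact f.map_zero
  | succ k ih =>
    change f.toFun (oplus _ _) = oplus _ _
    rw [f.map_oplus, ih]

theorem isomorphic_symm (h : Isomorphic A B) : Isomorphic B A := by
  obtain ⟨f, hf⟩ := h
  let e := Equiv.ofBijective _ hf
  have he : ∀ x, f.toFun (e.symm x) = x := e.apply_symm_apply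
  refine ⟨⟨e.symm, ?_, ?_, ?_⟩, e.symm.bijective⟩
  · intro x y
    apply hf.1
    rw [f.map_oplus, he, he, he]
  · intro x
    apply hf.1
    rw [f.map_neg, he, he]
  · apply hf.1
    rw [f.map_zero, he]

instance : MVAlgebra (ULift.{w} A) where
  oplus x y := ⟨oplus x.down y.down⟩
  neg x := ⟨neg x.down⟩
  zero := ⟨zero⟩
  oplus_assoc _ _ _ := congrArg ULift.up (oplus_assoc _ _ _)
  oplus_comm _ _ := congrArg ULift.up (oplus_comm _ _)
  oplus_zero _ := congrArg ULift.up (oplus_zero _)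
  neg_neg _ := congrArg ULift.up (MVAlgebra.neg_neg _)
  oplus_neg_zero _ := congrArg ULift.up (oplus_neg_zero _)
  lukasiewicz _ _ := congrArg ULift.up (lukasiewicz _ _)

variable (A) in
theorem isomorphic_ulift : Isomorphic A (ULift.{w} A) :=
  ⟨⟨ULift.up, fun _ _ => rfl, fun _ => rfl, rfl⟩, ULift.up_injective, ULift.up_surjective⟩

theorem Subalg.subset_closure (s : Set A) : s ⊆ (Subalg.closure s).carrier :=
  fun _ hx _ hS => hS hx

end Homs

/-! ### Closure properties of quasivarieties and varieties -/

section Classes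

theorem quasivarietyGenerated_isQuasivariety (G : Set Alg.{u}) :
    IsQuasivariety (quasivarietyGenerated G) where
  iso A hA B h Q hQ := hQ.1.iso A (hA Q hQ) B h
  sub A hA S Q hQ := hQ.1.sub A (hA Q hQ) S
  reducedProduct ι F A hA Q hQ := hQ.1.reducedProduct ι F A fun i => hA i Q hQ

theorem subset_quasivarietyGenerated (G : Set Alg.{u}) : G ⊆ quasivarietyGenerated G :=
  fun _ hA _ hQ => hQ.2 hA

theorem quasivarietyGenerated_subset {G Q : Set Alg.{u}} (hQ : IsQuasivariety Q) (h : G ⊆ Q) :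
    quasivarietyGenerated G ⊆ Q :=
  fun _ hA => hA Q ⟨hQ, h⟩

theorem varietyGenerated_isVariety (G : Set Alg.{u}) : IsVariety (varietyGenerated G) where
  hom A hA B h V hV := hV.1.hom A (hA V hV) B h
  sub A hA S V hV := hV.1.sub A (hA V hV) S
  prod ι A hA V hV := hV.1.prod ι A fun i => hA i V hV

theorem IsVariety.isQuasivariety {V : Set Alg.{u}} (hV : IsVariety V) : IsQuasivariety V where
  iso A hA B := fun ⟨f, hf⟩ => hV.hom A hA B ⟨f, hf.2⟩
  sub := hV.sub
  reducedProduct ι F A hA :=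
    hV.hom _ (hV.prod ι A hA) _ ⟨Hom.toReducedProduct F fun i => A i, Quotient.mk_surjective⟩

variable {K : Set Alg.{u}}

theorem IsQuasivariety.of_injective (hK : IsQuasivariety K) {A B : Alg.{u}} (hB : B ∈ K)
    (f : Hom A B) (hf : Function.Injective f.toFun) : A ∈ K :=
  hK.iso _ (hK.sub B hB f.range) A (isomorphic_symm
    ⟨f.codRestrict f.range fun x => ⟨x, rfl⟩,
      fun _ _ h => hf (congrArg Subtype.val h), fun ⟨_, x, hx⟩ => ⟨x, Subtype.ext hx⟩⟩)

/-- For the filter `⊤`, holding eventually means holding everywhere, so the reduced product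
identifies nothing. -/
theorem IsQuasivariety.pi (hK : IsQuasivariety K) {ι : Type u} {A : ι → Alg.{u}}
    (hA : ∀ i, A i ∈ K) : Alg.mk (∀ i, A i) ∈ K := by
  refine hK.of_injective (hK.reducedProduct ι ⊤ A hA) (Hom.toReducedProduct ⊤ fun i => A i) ?_
  intro x y h
  have h' : ∀ᶠ i in (⊤ : Filter ι), x i = y i := Quotient.exact h
  exact funext (Filter.eventually_top.1 h')

theorem IsQuasivariety.of_separating (hK : IsQuasivariety K) {B : Alg.{u}} {ι : Type u}
    {A : ι → Alg.{u}} (hA : ∀ i, A i ∈ K) (f : ∀ i, Hom B (A i))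
    (hf : ∀ x y, (∀ i, (f i).toFun x = (f i).toFun y) → x = y) : B ∈ K :=
  hK.of_injective (hK.pi hA) (Hom.pi f) fun x y h => hf x y (congrFun h)

/-- An algebra belongs to a quasivariety if its finitely generated subalgebras do. -/
theorem IsQuasivariety.of_fg (hK : IsQuasivariety K) (A : Alg.{u})
    (h : ∀ s : Set A, s.Finite → Alg.mk (Subalg.closure s).carrier ∈ K) : A ∈ K := by
  classical
  let F : Filter (Finset A) := Filter.atTop
  let C : Finset A → Alg.{u} := fun s => Alg.mk (Subalg.closure (s : Set A)).carrier
  -- An element `x` becomes the family constantly `x` wherever this makes sense. The default `zero`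
  -- is harmless, since `x` lies in the closure of every finite set containing it.
  let g : A → ∀ s, C s := fun x s =>
    if hx : x ∈ (Subalg.closure (s : Set A)).carrier then ⟨x, hx⟩ else zero
  have hg : ∀ (x : A) (s : Finset A) (hx : x ∈ (Subalg.closure (s : Set A)).carrier),
      g x s = ⟨x, hx⟩ := fun x s hx => dif_pos hx
  have hmem : ∀ x : A, ∀ᶠ s : Finset A in F, x ∈ (Subalg.closure (s : Set A)).carrier := fun x =>
    (Filter.eventually_ge_atTop {x}).mono fun s hs =>
      Subalg.subset_closure _ (hs (Finset.mem_singleton_self x))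
  let f : Hom A (F.Product fun s => C s) :=
    { toFun := fun x => Quotient.mk _ (g x)
      map_oplus := fun x y => by
        refine Quotient.sound (s := F.productSetoid _) ?_
        filter_upwards [hmem x, hmem y] with s hx hy
        have e := hg (oplus x y) s ((Subalg.closure _).oplus_mem hx hy)
        rw [e]
        change _ = oplus (g x s) (g y s)
        rw [hg x s hx, hg y s hy]
        rfl
      map_neg := fun x => by
        refine Quotient.sound (s := F.productSetoid _) ?_
        filter_upwards [hmem x] with s hx
        rw [hg (neg x) s ((Subalg.closure _).neg_mem hx)]
        change _ = neg (g x s)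
        rw [hg x s hx]
        rfl
      map_zero := by
        refine Quotient.sound (s := F.productSetoid _) ?_
        refine Filter.Eventually.of_forall fun s => ?_
        rw [hg zero s (Subalg.closure _).zero_mem]
        rfl }
  refine hK.of_injective (hK.reducedProduct _ F C fun s => h _ s.finite_toSet) f ?_
  intro x y hxy
  have hxy' : ∀ᶠ s in F, g x s = g y s := Quotient.exact hxy
  obtain ⟨s, hs, hx, hy⟩ := (hxy'.and ((hmem x).and (hmem y))).exists
  rw [hg x s hx, hg y s hy] at hs
  exact congrArg Subtype.val hs

theorem LocallyFiniteClass.finite_closure (hL : LocallyFiniteClass K) {A : Alg.{u}} (hA : A ∈ K)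
    {s : Set A} (hs : s.Finite) : Finite (Subalg.closure s).carrier :=
  hL A hA _ ⟨s, hs, rfl⟩

end Classes

/-! ### Terms, identities, and local finiteness from finite generation -/

section Terms

/-- Terms of MV-algebras in the variables `Fin n`. -/
inductive Term (n : ℕ) : Type
  | var : Fin n → Term n
  | oplus : Term n → Term n → Term n
  | neg : Term n → Term n
  | zero : Term n

/-- Evaluation of terms. -/
def Term.eval {n : ℕ} {A : Type u} [MVAlgebra A] (a : Fin n → A) : Term n → A
  | var i => a i
  | oplus s t => MVAlgebra.oplus (s.eval a) (t.eval a)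
  | neg t => MVAlgebra.neg (t.eval a)
  | zero => MVAlgebra.zero

variable {n : ℕ}

theorem Hom.map_eval {A : Type u} {B : Type v} [MVAlgebra A] [MVAlgebra B] (f : Hom A B)
    (a : Fin n → A) (t : Term n) : f.toFun (t.eval a) = t.eval (f.toFun ∘ a) := by
  induction t with
  | var i => rfl
  | oplus s t hs ht =>
    change f.toFun (MVAlgebra.oplus _ _) = MVAlgebra.oplus _ _
    rw [f.map_oplus, hs, ht]
  | neg t ht =>
    change f.toFun (MVAlgebra.neg _) = MVAlgebra.neg _
    rw [f.map_neg, ht]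
  | zero => exact f.map_zero

theorem closure_subset_range_eval {A : Type u} [MVAlgebra A] (a : Fin n → A) :
    (Subalg.closure (Set.range a)).carrier ⊆ Set.range fun t : Term n => t.eval a := by
  intro x hx
  refine hx ⟨Set.range fun t : Term n => t.eval a, ?_, ?_, ⟨.zero, rfl⟩⟩ ?_
  · rintro _ _ ⟨s, rfl⟩ ⟨t, rfl⟩
    exact ⟨.oplus s t, rfl⟩
  · rintro _ ⟨t, rfl⟩
    exact ⟨.neg t, rfl⟩
  · rintro _ ⟨i, rfl⟩
    exact ⟨.var i, rfl⟩

/-- The identity `s = t` holds in `A`. -/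
def Satisfies (A : Type u) [MVAlgebra A] (s t : Term n) : Prop :=
  ∀ a : Fin n → A, s.eval a = t.eval a

theorem Satisfies.of_surjective {A : Type u} {B : Type v} [MVAlgebra A] [MVAlgebra B]
    {s t : Term n} (h : Satisfies A s t) (f : Hom A B) (hf : Function.Surjective f.toFun) :
    Satisfies B s t := by
  intro b
  obtain ⟨g, hg⟩ := hf.hasRightInverse
  have e : f.toFun ∘ (g ∘ b) = b := funext fun i => hg (b i)
  rw [← e, ← f.map_eval, ← f.map_eval, h]

theorem Satisfies.of_injective {A : Type u} {B : Type v} [MVAlgebra A] [MVAlgebra B]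
    {s t : Term n} (h : Satisfies B s t) (f : Hom A B) (hf : Function.Injective f.toFun) :
    Satisfies A s t := by
  intro a
  apply hf
  rw [f.map_eval, f.map_eval, h]

theorem Satisfies.pi {ι : Type w} {A : ι → Type v} [∀ i, MVAlgebra (A i)] {s t : Term n}
    (h : ∀ i, Satisfies (A i) s t) : Satisfies (∀ i, A i) s t := by
  intro a
  funext i
  have hs := (Hom.proj A i).map_eval a s
  have ht := (Hom.proj A i).map_eval a t
  exact hs.trans ((h i _).trans ht.symm)

/-- The algebras satisfying a set of identities form a variety. -/
theorem isVariety_setOf_satisfies (E : ∀ n, Term n → Term n → Prop) :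
    IsVariety {A : Alg.{u} | ∀ n s t, E n s t → Satisfies A s t} where
  hom _ hA _ := fun ⟨f, hf⟩ n s t h => (hA n s t h).of_surjective f hf
  sub _ hA S n s t h := (hA n s t h).of_injective S.incl Subtype.val_injective
  prod _ _ hA n s t h := Satisfies.pi fun i => hA i n s t h

/-- A quasivariety generated by finitely many finite algebras is locally finite. -/
theorem locallyFinite_of_finitelyGenerated {K : Set Alg.{u}}
    (hK : FinitelyGeneratedQuasivariety K) : LocallyFiniteClass K := by
  obtain ⟨G, hG, hfin, rfl⟩ := hK
  rintro A hA _ ⟨s, hs, rfl⟩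
  have hV := isVariety_setOf_satisfies.{u} fun n s t => ∀ B ∈ G, Satisfies B s t
  have hAV := quasivarietyGenerated_subset hV.isQuasivariety
    (fun B hB n s t h => h B hB) hA
  obtain ⟨n, a, rfl⟩ : ∃ (n : ℕ) (a : Fin n → A), Set.range a = s := by
    have := hs.to_subtype
    obtain ⟨n, ⟨e⟩⟩ := Finite.exists_equiv_fin s
    exact ⟨n, fun i => (e.symm i).1, by
      rw [Set.range_comp' Subtype.val e.symm, e.symm.range_eq_univ, Set.image_univ,
        Subtype.range_coe]⟩
  have := hG.to_subtype
  have : ∀ B : G, Finite B.1 := fun B => hfin B.1 B.2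
  -- `φ` sends a term to its term functions on the generators. Its codomain is finite, and terms
  -- with equal image form an identity of the generated quasivariety.
  let φ : Term n → ∀ B : G, (Fin n → B.1) → B.1 := fun t B b => t.eval b
  have hφ : ∀ s t : Term n, φ s = φ t → s.eval a = t.eval a := fun s t h =>
    hAV n s t (fun B hB b => congrFun (congrFun h ⟨B, hB⟩) b) a
  have hfact : Set.range (fun t : Term n => t.eval a) ⊆
      Set.range fun p : Set.range φ => (Classical.choose p.2).eval a := by
    rintro _ ⟨t, rfl⟩
    exact ⟨⟨φ t, t, rfl⟩, hφ _ _ (Classical.choose_spec (⟨t, rfl⟩ : φ t ∈ Set.range φ))⟩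
  exact (Set.finite_range _).subset ((closure_subset_range_eval a).trans hfact)

end Terms

/-! ### Bounded stabilisation of multiples and varieties of chains -/

section Bounded

/-- The algebras in which sums of equal elements stabilise after `M` steps form a variety. -/
theorem isVariety_nmul (M : ℕ) :
    IsVariety {A : Alg.{u} | ∀ x : A, nmul (M + 1) x = nmul M x} where
  hom A hA B := by
    rintro ⟨f, hf⟩ y
    obtain ⟨x, rfl⟩ := hf y
    rw [← f.map_nmul, ← f.map_nmul, hA]
  sub A hA S x := by
    apply Subtype.val_injective
    have h1 := S.incl.map_nmul (M + 1) x
    have h2 := S.incl.map_nmul M x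
    exact h1.trans ((hA _).trans h2.symm)
  prod ι A hA x := by
    funext i
    have h1 := (Hom.proj (fun i => A i) i).map_nmul (M + 1) x
    have h2 := (Hom.proj (fun i => A i) i).map_nmul M x
    exact h1.trans ((hA i _).trans h2.symm)

theorem chain_nmul (n : ℕ+) (k : ℕ) (x : (chain n).carrier) :
    (nmul k x).1.1 = min 1 (k * x.1.1) := by
  induction k with
  | zero =>
    change (0 : ℚ) = _
    simp
  | succ k ih =>
    change min 1 ((nmul k x).1.1 + x.1.1) = _
    rw [ih]
    have := x.1.2.1
    push_cast
    rw [add_mul, one_mul]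
    rcases min_cases (1 : ℚ) (k * x.1.1) with h | h
    · rw [h.1, min_eq_left (by linarith), min_eq_left (by linarith)]
    · rw [h.1]

theorem chain_nmul_succ {n : ℕ+} {M : ℕ} (h : (n : ℕ) ≤ M) (x : (chain n).carrier) :
    nmul (M + 1) x = nmul M x := by
  apply Subtype.ext
  apply Subtype.ext
  rw [chain_nmul, chain_nmul]
  obtain ⟨k, hk, e⟩ := x.2
  have hn : (0 : ℚ) < (n : ℕ) := by exact_mod_cast n.pos
  have hM : ((n : ℕ) : ℚ) ≤ M := by exact_mod_cast h
  rw [e]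
  rcases Nat.eq_zero_or_pos k with rfl | hk
  · simp
  · have hk : (1 : ℚ) ≤ k := by exact_mod_cast hk
    have : (1 : ℚ) ≤ M * (k / (n : ℕ)) := by
      rw [← mul_div_assoc, le_div_iff₀ hn]
      nlinarith
    rw [min_eq_left this, min_eq_left]
    have : (0 : ℚ) ≤ k / (n : ℕ) := by positivity
    push_cast
    linarith

/-- The witness is `1 / (M + 1)`, whose multiples first reach the top at step `M + 1`. -/
theorem chain_nmul_succ_ne (M : ℕ) :
    ∃ x : (chain M.succPNat).carrier, nmul (M + 1) x ≠ nmul M x := by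
  have hM : (0 : ℚ) < (M : ℚ) + 1 := by positivity
  refine ⟨⟨⟨1 / (M + 1), by positivity, by
    rw [div_le_one₀ hM]
    linarith [(Nat.cast_nonneg M : (0 : ℚ) ≤ M)]⟩, 1, by simp, by simp⟩, ?_⟩
  intro h
  have h' := congrArg (fun z => z.1.1) h
  simp only [chain_nmul] at h'
  push_cast at h'
  rw [mul_one_div_cancel hM.ne', min_self, mul_one_div, min_eq_right, eq_comm,
    div_eq_one_iff_eq hM.ne'] at h'
  · linarith
  · rw [div_le_one₀ hM]
    linarith

theorem chainVariety_nmul {N : Set ℕ+} {M : ℕ} (hN : ∀ n ∈ N, (n : ℕ) ≤ M) {A : Alg.{u}}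
    (hA : A ∈ chainVariety N) (x : A) : nmul (M + 1) x = nmul M x := by
  refine hA _ ⟨isVariety_nmul M, ?_⟩ x
  rintro B ⟨n, hn, f, hf⟩ x
  apply hf.1
  rw [f.map_nmul, f.map_nmul, chain_nmul_succ (hN n hn)]

theorem chainVariety_ne_univ (N : Finset ℕ+) : chainVariety.{u} (N : Set ℕ+) ≠ Set.univ := by
  intro h
  obtain ⟨M, hM⟩ : ∃ M : ℕ, ∀ n ∈ N, (n : ℕ) ≤ M :=
    ⟨N.sup fun n => (n : ℕ), fun n hn => Finset.le_sup (f := fun n : ℕ+ => (n : ℕ)) hn⟩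
  obtain ⟨x, hx⟩ := chain_nmul_succ_ne M
  have hA : Alg.mk (ULift.{u} (chain M.succPNat).carrier) ∈ chainVariety.{u} (N : Set ℕ+) :=
    h ▸ Set.mem_univ _
  obtain ⟨f, hf⟩ := isomorphic_ulift.{0, u} (chain M.succPNat).carrier
  apply hx
  apply hf.1
  rw [f.map_nmul, f.map_nmul]
  exact chainVariety_nmul hM hA _

/-- Finite algebras in which sums stabilise after `M` steps lie in the variety generated by the
chains of length at most `M`. -/
theorem mem_chainVariety_of_finite {A : Alg.{u}} [Finite A] {M : ℕ} {N : Set ℕ+}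
    (hN : ∀ n : ℕ+, (n : ℕ) ≤ M → n ∈ N) (hA : ∀ x : A, nmul (M + 1) x = nmul M x) :
    A ∈ chainVariety N := by
  have hV := (varietyGenerated_isVariety {A : Alg.{u} | ∃ n ∈ N,
    Isomorphic A (chain n).carrier}).isQuasivariety
  have hp : ∀ p : {p : A × ULift.{u} ℕ // IsAtomOfOrder p.1 p.2.down}, 0 < p.1.2.down :=
    fun p => p.2.pos
  have hh : ∀ p : {p : A × ULift.{u} ℕ // IsAtomOfOrder p.1 p.2.down},
      IsAtomOfOrder p.1.1 ((⟨p.1.2.down, hp p⟩ : ℕ+) : ℕ) := fun p => p.2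
  obtain ⟨up, hup⟩ : ∃ up : ∀ n : ℕ+, Hom (chain n).carrier (ULift.{u} (chain n).carrier),
      ∀ n, Function.Bijective (up n).toFun :=
    ⟨_, fun n => (isomorphic_ulift.{0, u} (chain n).carrier).choose_spec⟩
  refine hV.of_separating
    (A := fun p : {p : A × ULift.{u} ℕ // IsAtomOfOrder p.1 p.2.down} =>
      Alg.mk (ULift.{u} (chain ⟨p.1.2.down, hp p⟩).carrier)) ?_
    (fun p => (up _).comp (hh p).hom) ?_
  · intro p V hV
    exact hV.2 ⟨_, hN ⟨p.1.2.down, hp p⟩ (p.2.le_of_nmul_succ_eq (hA _)),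
      isomorphic_symm (isomorphic_ulift _)⟩
  · intro x y h
    apply eq_of_forall_coord_eq
    intro a n ha
    exact (hh ⟨(a, ⟨n⟩), ha⟩).coord_eq_of_hom_eq ((hup _).1 (h ⟨(a, ⟨n⟩), ha⟩))

/-- In a locally finite quasivariety sums of equal elements stabilise after boundedly many
steps. -/
theorem LocallyFiniteClass.exists_nmul {K : Set Alg.{u}} (hK : IsQuasivariety K)
    (hL : LocallyFiniteClass K) : ∃ M : ℕ, ∀ A ∈ K, ∀ x : A, nmul (M + 1) x = nmul M x := by
  by_contra! H
  choose A hA x hx using H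
  let P : ULift.{u} ℕ → Alg.{u} := fun i => A i.down
  -- The component of `y` at `k` violates stabilisation at step `k`, so the multiples of `y` never
  -- stabilise, although `y` generates a finite subalgebra.
  let y : ∀ i, P i := fun i => x i.down
  have hP : Alg.mk (∀ i, P i) ∈ K := hK.pi fun i => hA i.down
  have hfin : Finite (Subalg.closure {y}).carrier := hL.finite_closure hP (Set.finite_singleton y)
  let z : (Subalg.closure {y}).carrier := ⟨y, Subalg.subset_closure _ rfl⟩
  obtain ⟨k, hk⟩ := exists_nmul_succ_eq z
  apply hx k
  let f := (Hom.proj (fun i => P i) ⟨k⟩).comp (Subalg.closure {y}).incl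
  have := congrArg f.toFun hk
  rwa [f.map_nmul, f.map_nmul] at this

theorem subset_chainVariety_of_locallyFinite {K : Set Alg.{u}} (hK : IsQuasivariety K)
    (hL : LocallyFiniteClass K) : ∃ N : Finset ℕ+, K ⊆ chainVariety (N : Set ℕ+) := by
  obtain ⟨M, hM⟩ := LocallyFiniteClass.exists_nmul hK hL
  -- The bound `M + 1` rather than `M` keeps the endpoint positive when `M = 0`.
  refine ⟨Finset.Icc 1 M.succPNat, fun A hA => ?_⟩
  refine (varietyGenerated_isVariety _).isQuasivariety.of_fg A fun s hs => ?_
  have hfin := hL.finite_closure hA hs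
  refine mem_chainVariety_of_finite (A := Alg.mk (Subalg.closure s).carrier) (M := M) ?_
    (hM _ (hK.sub A hA _))
  intro n hn
  rw [Finset.coe_Icc]
  refine ⟨one_le, ?_⟩
  rw [← PNat.coe_le_coe]
  exact hn.trans (Nat.le_succ M)

end Bounded

/-! ### Critical algebras and the theorem -/

section Critical

/-- Copying the coordinate at `a` onto `b`, and the one at `b` onto `a`, gives two homomorphisms
into the proper subalgebra where these coordinates agree. Jointly they are injective, which
contradicts criticality. -/
theorem IsCritical.atom_unique {A : Alg.{u}} (hA : IsCritical A) {a b : A} {n : ℕ}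
    (ha : IsAtomOfOrder a n) (hb : IsAtomOfOrder b n) : a = b := by
  by_contra hne
  have := hA.1
  apply hA.2
  have hQ := quasivarietyGenerated_isQuasivariety
    {B : Alg.{u} | ∃ S : Subalg A, S.carrier ≠ Set.univ ∧ B = Alg.mk S.carrier}
  have hS : Alg.mk (coordEqualizer ha hb).carrier ∈ quasivarietyGenerated
      {B : Alg.{u} | ∃ S : Subalg A, S.carrier ≠ Set.univ ∧ B = Alg.mk S.carrier} :=
    subset_quasivarietyGenerated _ ⟨_, coordEqualizer_ne_univ ha hb hne, rfl⟩
  let f : ULift.{u} Bool → Hom A (coordEqualizer ha hb).carrier := fun i =>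
    if i.down then
      (transferHom ha hb).codRestrict _ (transfer_mem_coordEqualizer ha hb hne)
    else (transferHom hb ha).codRestrict _ (transfer_mem_coordEqualizer' ha hb hne)
  refine hQ.of_separating (A := fun _ : ULift.{u} Bool => Alg.mk _) (fun _ => hS) f ?_
  intro x y h
  exact eq_of_transfer_eq ha hb hne (congrArg Subtype.val (h ⟨true⟩))
    (congrArg Subtype.val (h ⟨false⟩))

theorem IsCritical.card_le {A : Alg.{u}} (hA : IsCritical A) {M : ℕ}
    (hM : ∀ x : A, nmul (M + 1) x = nmul M x) : Nat.card A ≤ (M + 1) ^ (M + 1) := by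
  classical
  have := hA.1
  -- Slot `i` records the coordinate at the unique atom of order `i`, and the constant `0` if there
  -- is none.
  let f : A → Fin (M + 1) → Fin (M + 1) := fun x i =>
    if h : ∃ a : A, IsAtomOfOrder a (i : ℕ) then
      ⟨coord h.choose i x, (coord_le _ _ _).trans_lt i.2⟩ else 0
  have hf : Function.Injective f := by
    intro x y h
    apply eq_of_forall_coord_eq
    intro a n ha
    have hn : n < M + 1 := Nat.lt_succ_of_le (ha.le_of_nmul_succ_eq (hM a))
    have hex : ∃ a : A, IsAtomOfOrder a n := ⟨a, ha⟩
    have e := congrFun h ⟨n, hn⟩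
    simp only [f, dif_pos hex, Fin.mk.injEq] at e
    rwa [hA.atom_unique hex.choose_spec ha] at e
  simpa using Nat.card_le_card_of_injective f hf

theorem mvAlgebra_finite (B : Type u) [Finite B] : Finite (MVAlgebra B) := by
  refine Finite.of_injective
    (fun s : MVAlgebra B => (s.oplus, s.neg, s.zero)) ?_
  rintro ⟨⟩ ⟨⟩ h
  simp only [Prod.mk.injEq] at h
  obtain ⟨rfl, rfl, rfl⟩ := h
  rfl

/-- Transport of structure along a bijection. -/
theorem exists_isomorphic_of_equiv {A B : Type u} [MVAlgebra A] (e : A ≃ B) :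
    ∃ _ : MVAlgebra B, Isomorphic A B := by
  let s : MVAlgebra B :=
    { oplus := fun x y => e (oplus (e.symm x) (e.symm y))
      neg := fun x => e (neg (e.symm x))
      zero := e zero
      oplus_assoc := fun x y z => by simp [oplus_assoc]
      oplus_comm := fun x y => by simp [oplus_comm (e.symm x)]
      oplus_zero := fun x => by simp [oplus_zero]
      neg_neg := fun x => by simp [MVAlgebra.neg_neg]
      oplus_neg_zero := fun x => by simp [oplus_neg_zero]
      lukasiewicz := fun x y => by simp [lukasiewicz (e.symm x)] }
  refine ⟨s, ⟨e, ?_, ?_, rfl⟩, e.bijective⟩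
  · intro x y
    change _ = e (oplus (e.symm (e x)) (e.symm (e y)))
    simp
  · intro x
    change _ = e (neg (e.symm (e x)))
    simp

/-- Up to isomorphism there are only finitely many algebras of bounded finite size. -/
theorem finiteUpToIso_of_card_le {K : Set Alg.{u}} {m : ℕ}
    (h : ∀ A ∈ K, Finite A ∧ Nat.card A ≤ m) : FiniteUpToIso K := by
  have : ∀ i : Fin (m + 1), Finite (MVAlgebra (ULift.{u} (Fin i))) := fun i => mvAlgebra_finite _
  refine ⟨Set.range fun p : Σ i : Fin (m + 1), MVAlgebra (ULift.{u} (Fin i)) =>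
    @Alg.mk _ p.2, Set.finite_range _, fun A hA => ?_⟩
  obtain ⟨hfin, hcard⟩ := h A hA
  obtain ⟨s, hs⟩ := exists_isomorphic_of_equiv
    ((Finite.equivFin A).trans Equiv.ulift.{u}.symm)
  exact ⟨_, ⟨⟨⟨Nat.card A, Nat.lt_succ_of_le hcard⟩, s⟩, rfl⟩, hs⟩

theorem finiteUpToIso_critical (N : Finset ℕ+) :
    FiniteUpToIso {A : Alg.{u} | A ∈ chainVariety (N : Set ℕ+) ∧ IsCritical A} := by
  obtain ⟨M, hM⟩ : ∃ M : ℕ, ∀ n ∈ N, (n : ℕ) ≤ M :=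
    ⟨N.sup fun n => (n : ℕ), fun n hn => Finset.le_sup (f := fun n : ℕ+ => (n : ℕ)) hn⟩
  exact finiteUpToIso_of_card_le fun A hA =>
    ⟨hA.2.1, hA.2.card_le fun x => chainVariety_nmul hM hA.1 x⟩

/-- Induction on size: a finite algebra that is not critical belongs to the quasivariety of its
proper subalgebras, which are smaller members of `K`. -/
theorem finite_mem_quasivarietyGenerated_critical {K : Set Alg.{u}} (hK : IsQuasivariety K)
    (m : ℕ) (A : Alg.{u}) [Finite A] (hA : A ∈ K) (hm : Nat.card A = m) :
    A ∈ quasivarietyGenerated {A | A ∈ K ∧ IsCritical A} := by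
  induction m using Nat.strong_induction_on generalizing A with
  | _ m ih =>
    by_cases hc : IsCritical A
    · exact subset_quasivarietyGenerated _ ⟨hA, hc⟩
    · have hmem : A ∈ quasivarietyGenerated
          {B : Alg.{u} | ∃ S : Subalg A, S.carrier ≠ Set.univ ∧ B = Alg.mk S.carrier} := by
        by_contra h
        exact hc ⟨inferInstance, h⟩
      refine quasivarietyGenerated_subset (quasivarietyGenerated_isQuasivariety _) ?_ hmem
      rintro _ ⟨S, hS, rfl⟩
      refine ih (Nat.card S.carrier) ?_ (Alg.mk S.carrier) (hK.sub A hA S) rfl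
      rw [← hm]
      exact (Set.ncard_lt_card hS)

theorem eq_quasivarietyGenerated_critical {K : Set Alg.{u}} (hK : IsQuasivariety K)
    (hL : LocallyFiniteClass K) : K = quasivarietyGenerated {A | A ∈ K ∧ IsCritical A} := by
  apply Set.Subset.antisymm
  · intro A hA
    refine (quasivarietyGenerated_isQuasivariety _).of_fg A fun s hs => ?_
    have : Finite (Alg.mk (Subalg.closure s).carrier) := hL.finite_closure hA hs
    exact finite_mem_quasivarietyGenerated_critical hK _ _ (hK.sub A hA _) rfl
  · exact quasivarietyGenerated_subset hK fun A hA => hA.1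

theorem finitelyGenerated_of_locallyFinite {K : Set Alg.{u}} (hK : IsQuasivariety K)
    (hL : LocallyFiniteClass K) : FinitelyGeneratedQuasivariety K := by
  obtain ⟨N, hN⟩ := subset_chainVariety_of_locallyFinite hK hL
  obtain ⟨F, hF, hiso⟩ := finiteUpToIso_critical.{u} N
  -- The representatives in `F` need not all be finite or belong to `K`, so they are filtered; those
  -- isomorphic to critical members of `K` survive.
  refine ⟨{B ∈ F | B ∈ K ∧ Finite B}, hF.subset (Set.sep_subset _ _), fun A hA => hA.2.2, ?_⟩
  apply Set.Subset.antisymm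
  · refine (eq_quasivarietyGenerated_critical hK hL).subset.trans ?_
    refine quasivarietyGenerated_subset (quasivarietyGenerated_isQuasivariety _) ?_
    rintro A ⟨hA, hc⟩
    obtain ⟨B, hB, hAB⟩ := hiso A ⟨hN hA, hc⟩
    have hfin : Finite B := by
      obtain ⟨f, hf⟩ := hAB
      have := hc.1
      exact Finite.of_surjective _ hf.2
    have hBG : B ∈ {B ∈ F | B ∈ K ∧ Finite B} := ⟨hB, hK.iso A hA B hAB, hfin⟩
    exact (quasivarietyGenerated_isQuasivariety _).iso B
      (subset_quasivarietyGenerated _ hBG) A (isomorphic_symm hAB)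
  · exact quasivarietyGenerated_subset hK fun A hA => hA.2.1

end Critical

end MV

theorem theorem2p7 (K : Set MV.Alg.{u}) (hK : MV.IsQuasivariety K) :
    (MV.LocallyFiniteClass K ↔ MV.FinitelyGeneratedQuasivariety K) ∧
    (MV.LocallyFiniteClass K →
      (∃ N : Finset ℕ+,
        K ⊆ MV.chainVariety (N : Set ℕ+) ∧
        MV.chainVariety.{u} (N : Set ℕ+) ≠ Set.univ ∧
        MV.FiniteUpToIso {A : MV.Alg.{u} | A ∈ MV.chainVariety (N : Set ℕ+) ∧ MV.IsCritical A}) ∧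
      K = MV.quasivarietyGenerated {A | A ∈ K ∧ MV.IsCritical A}) := by
  refine ⟨⟨MV.finitelyGenerated_of_locallyFinite hK, MV.locallyFinite_of_finitelyGenerated⟩,
    fun hL => ⟨?_, MV.eq_quasivarietyGenerated_critical hK hL⟩⟩
  obtain ⟨N, hN⟩ := MV.subset_chainVariety_of_locallyFinite hK hL
  exact ⟨N, hN, MV.chainVariety_ne_univ N, MV.finiteUpToIso_critical N⟩
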